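/- **Theorem (Minimizing the first Robin eigenvalue on rectangles, with length scaling).** A rectangle is a product $R=(x_0,x_1)\times(y_0,y_1)\subset\mathbb R^2$ of two bounded, nonempty open intervals; $A(R)$ denotes its area and $L(R)$ the length of $\partial R$. For $\beta\in\mathbb R$, let $\lambda_1(R;\beta)$ be the first (smallest) eigenvalue of the Robin Laplacian \[ -\Delta u=\lambda u \ \text{ in } R,\qquad \frac{\partial u}{\partial\nu}+\beta u=0\ \text{ on } \partial R, \] in the weak sense: $\lambda\in\mathbb R$ is an eigenvalue if there is $u\in H^1(R)$, $u\neq 0$, with \[ \int_R\nabla u\cdot\nabla v\,dx+\beta\int_{\partial R}uv\,dS=\lambda\int_R uv\,dx\qquad\text{for all } v\in H^1(R), \] boundary values being understood as traces. Let $\alpha\in\mathbb R$, $\alpha\neq 0$ (positive or negative). Then the smallest eigenvalue $\lambda_1(R;\alpha/L(R))$ exists for every rectangle $R$; the quantity \[ \lambda_1\big(R;\alpha/L(R)\big)\,A(R) \] is unchanged when $R$ is replaced by $tR$, $t>0$; and among all rectangles it is minimal for the square and only the square, that is, for every square $S$ and every rectangle $R$, \[ \lambda_1\big(S;\alpha/L(S)\big)A(S)\le\lambda_1\big(R;\alpha/L(R)\big)A(R),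 \] with equality if and only if $R$ is a square. -/

import Mathlib

open MeasureTheory Set Filter Topology
open scoped ContDiff ENNReal

/-- A (nonempty, bounded) rectangle in the plane with sides parallel to the axes, given as the
product `(x₀, x₁) × (y₀, y₁)` of two open intervals. -/
structure Rectangle where
  x₀ : ℝ
  x₁ : ℝ
  y₀ : ℝ
  y₁ : ℝ
  hx : x₀ < x₁
  hy : y₀ < y₁

namespace Rectangle

/-- The open rectangle as a subset of the plane. -/
def carrier (R : Rectangle) : Set (ℝ × ℝ) := Ioo R.x₀ R.x₁ ×ˢ Ioo R.y₀ R.y₁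

/-- The horizontal side length. -/
def width (R : Rectangle) : ℝ := R.x₁ - R.x₀

/-- The vertical side length. -/
def height (R : Rectangle) : ℝ := R.y₁ - R.y₀

/-- The area `A`. -/
def area (R : Rectangle) : ℝ := R.width * R.height

/-- The perimeter `L`, the length of the boundary. -/
def perimeter (R : Rectangle) : ℝ := 2 * (R.width + R.height)

/-- A square is a rectangle whose sides all have the same length. -/
def IsSquare (R : Rectangle) : Prop := R.width = R.height

/-- The dilated rectangle `t R`, for `t > 0`. -/
def dilate (R : Rectangle) (t : ℝ) (ht : 0 < t) : Rectangle where
  x₀ := t * R.x₀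
  x₁ := t * R.x₁
  y₀ := t * R.y₀
  y₁ := t * R.y₁
  hx := mul_lt_mul_of_pos_left R.hx ht
  hy := mul_lt_mul_of_pos_left R.hy ht

/-- Lebesgue measure restricted to the rectangle. -/
noncomputable def interiorMeasure (R : Rectangle) : Measure (ℝ × ℝ) :=
  volume.restrict R.carrier

/-- Arc length measure on the boundary of the rectangle: the sum of the one-dimensional Lebesgue
measures on the bottom, top, left and right sides. -/
noncomputable def boundaryMeasure (R : Rectangle) : Measure (ℝ × ℝ) :=
  (volume.restrict (Icc R.x₀ R.x₁)).map (fun x => (x, R.y₀)) +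
  (volume.restrict (Icc R.x₀ R.x₁)).map (fun x => (x, R.y₁)) +
  (volume.restrict (Icc R.y₀ R.y₁)).map (fun y => (R.x₀, y)) +
  (volume.restrict (Icc R.y₀ R.y₁)).map (fun y => (R.x₁, y))

theorem area_eq (R : Rectangle) : R.area = (R.interiorMeasure univ).toReal := by
  have h1 : 0 ≤ R.x₁ - R.x₀ := sub_nonneg.2 R.hx.le
  have h2 : 0 ≤ R.y₁ - R.y₀ := sub_nonneg.2 R.hy.le
  simp [area, width, height, interiorMeasure, carrier, Measure.volume_eq_prod,
    Measure.prod_prod, h1, h2]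

theorem perimeter_eq (R : Rectangle) : R.perimeter = (R.boundaryMeasure univ).toReal := by
  have h1 : 0 ≤ R.x₁ - R.x₀ := sub_nonneg.2 R.hx.le
  have h2 : 0 ≤ R.y₁ - R.y₀ := sub_nonneg.2 R.hy.le
  unfold boundaryMeasure
  simp only [Measure.add_apply]
  rw [Measure.map_apply (by fun_prop) MeasurableSet.univ,
    Measure.map_apply (by fun_prop) MeasurableSet.univ,
    Measure.map_apply (by fun_prop) MeasurableSet.univ,
    Measure.map_apply (by fun_prop) MeasurableSet.univ]
  simp only [preimage_univ, Measure.restrict_apply_univ, Real.volume_Icc]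
  rw [← ENNReal.ofReal_add h1 h1, ← ENNReal.ofReal_add (add_nonneg h1 h1) h2,
    ← ENNReal.ofReal_add (add_nonneg (add_nonneg h1 h1) h2) h2,
    ENNReal.toReal_ofReal (add_nonneg (add_nonneg (add_nonneg h1 h1) h2) h2)]
  unfold perimeter width height
  ring

end Rectangle

/-- `g` is the weak derivative of `u` in the open set `Ω` in the direction `w`: integration by
parts holds against every smooth function with compact support in `Ω`. -/
def HasWeakDeriv (Ω : Set (ℝ × ℝ)) (w : ℝ × ℝ) (u g : ℝ × ℝ → ℝ) : Prop :=
  ∀ φ : ℝ × ℝ → ℝ, ContDiff ℝ ∞ φ → HasCompactSupport φ → tsupport φ ⊆ Ω →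
    ∫ z in Ω, u z * fderiv ℝ φ z w = - ∫ z in Ω, g z * φ z

/-- An element of the Sobolev space `H¹(R)`: a function in `L²(R)` together with its weak partial
derivatives, which are in `L²(R)`. (Representatives, to be read up to almost everywhere
equality.) -/
structure SobolevH1 (R : Rectangle) where
  u : ℝ × ℝ → ℝ
  dx : ℝ × ℝ → ℝ
  dy : ℝ × ℝ → ℝ
  memLp_u : MemLp u 2 R.interiorMeasure
  memLp_dx : MemLp dx 2 R.interiorMeasure
  memLp_dy : MemLp dy 2 R.interiorMeasure
  hasWeakDeriv_dx : HasWeakDeriv R.carrier (1, 0) u dx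
  hasWeakDeriv_dy : HasWeakDeriv R.carrier (0, 1) u dy

/-- `g ∈ L²(∂R)` is the boundary trace of `v ∈ H¹(R)`: the trace operator is the continuous
extension to `H¹(R)` of the restriction to `∂R` of functions that are smooth up to the boundary,
that is, some sequence of smooth functions on the plane converges to `v` in `H¹(R)` while its
restrictions to `∂R` converge to `g` in `L²(∂R)`. -/
def IsTrace {R : Rectangle} (v : SobolevH1 R) (g : ℝ × ℝ → ℝ) : Prop :=
  MemLp g 2 R.boundaryMeasure ∧
  ∃ f : ℕ → ℝ × ℝ → ℝ,
    (∀ n, ContDiff ℝ ∞ (f n)) ∧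
    Tendsto (fun n => eLpNorm (fun z => f n z - v.u z) 2 R.interiorMeasure) atTop (𝓝 0) ∧
    Tendsto (fun n => eLpNorm (fun z => fderiv ℝ (f n) z (1, 0) - v.dx z) 2 R.interiorMeasure)
      atTop (𝓝 0) ∧
    Tendsto (fun n => eLpNorm (fun z => fderiv ℝ (f n) z (0, 1) - v.dy z) 2 R.interiorMeasure)
      atTop (𝓝 0) ∧
    Tendsto (fun n => eLpNorm (fun z => f n z - g z) 2 R.boundaryMeasure) atTop (𝓝 0)

/-- `l` is an eigenvalue of the Robin Laplacian on `R` with Robin parameter `β`: the problem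
`-Δu = l u` in `R`, `∂u/∂ν + β u = 0` on `∂R`, has a nonzero weak solution `u ∈ H¹(R)`, meaning
`∫_R ∇u·∇v + β ∫_{∂R} u v = l ∫_R u v` for all `v ∈ H¹(R)`. -/
def IsRobinEigenvalue (R : Rectangle) (β l : ℝ) : Prop :=
  ∃ (u : SobolevH1 R) (g : ℝ × ℝ → ℝ), IsTrace u g ∧ ¬ (u.u =ᵐ[R.interiorMeasure] 0) ∧
    ∀ (v : SobolevH1 R) (h : ℝ × ℝ → ℝ), IsTrace v h →
      (∫ z, (u.dx z * v.dx z + u.dy z * v.dy z) ∂(R.interiorMeasure))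
        + β * (∫ z, g z * h z ∂(R.boundaryMeasure))
        = l * ∫ z, u.u z * v.u z ∂(R.interiorMeasure)

/-- The first (lowest) eigenvalue `λ₁(R; β)` of the Robin Laplacian on `R`. -/
noncomputable def robinLambda1 (R : Rectangle) (β : ℝ) : ℝ :=
  sInf {l : ℝ | IsRobinEigenvalue R β l}

/-- The quantity `λ₁(R; α/L) A`. -/
noncomputable def scaledLambda1 (α : ℝ) (R : Rectangle) : ℝ :=
  robinLambda1 R (α / R.perimeter) * R.area

/-! The problem separates: if `φ` and `ψ` are positive ground states on the two sides, with
eigenvalues `l₁` and `l₂`, then `φ(x)ψ(y)` is an eigenfunction for `l₁ + l₂`. No eigenvalue is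
smaller, because the one-dimensional Rayleigh inequality, applied on every horizontal and vertical
line and integrated, makes the form at `l₁ + l₂` nonnegative (`isLeast_isRobinEigenvalue`).

On an interval of length `w` the ground state is a centred `cosh(Xx/w)` for `β < 0` and `cos(Xx/w)`
for `β > 0`. Let `t = |β| w`, and write the eigenvalue times `w²` as `-P t`. Then `t = X tanh(X/2)`,
`P = X coth(X/2)` in the first case, and `t = X tan(X/2)`, `P = -X cot(X/2)` in the second. With `β
= α/L`, the two sides of a rectangle have parameters `t₁ + t₂ = |α|/2`, and the scaled eigenvalue is
`-(t₂ P₁ + t₁ P₂)`. Both expressions are scale invariant, and a square sits at the midpoint `t₁ =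
t₂`.

It remains to see that `t₂ P₁ + t₁ P₂` is strictly largest at the midpoint. For `P = t³` it equals
`t₁ t₂ (t₁² + t₂²) = 2(m⁴ - d⁴)` with `t₁, t₂ = m ∓ d`. Cauchy's mean value theorem against `t³`
extends this to every increasing `P` with `dP/d(t³)` decreasing (`cross_mul_lt_of_antitoneOn`). That
monotonicity is `antitoneOn_hyperbolic_ratio` and `antitoneOn_trigonometric_ratio`. -/

/-! ### Robin ground states on an interval -/

/-- `φ` is a positive eigenfunction, for the eigenvalue `l`, of the Robin problem with parameter
`β` on the interval `[a, b]`. -/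
structure IsRobinGroundState (a b β l : ℝ) (φ : ℝ → ℝ) : Prop where
  contDiff : ContDiff ℝ ∞ φ
  pos : ∀ x ∈ Icc a b, 0 < φ x
  ode : ∀ x, HasDerivAt (deriv φ) (-l * φ x) x
  left : deriv φ a = β * φ a
  right : deriv φ b = -β * φ b

namespace IsRobinGroundState

variable {a b β l : ℝ} {φ : ℝ → ℝ}

theorem hasDerivAt (h : IsRobinGroundState a b β l φ) (x : ℝ) : HasDerivAt φ (deriv φ x) x :=
  (h.contDiff.differentiable (by simp) x).hasDerivAt

theorem continuous_deriv (h : IsRobinGroundState a b β l φ) : Continuous (deriv φ) :=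
  h.contDiff.continuous_deriv (by simp)

theorem weak_eq (h : IsRobinGroundState a b β l φ) {f f' : ℝ → ℝ}
    (hf : ∀ x, HasDerivAt f (f' x) x) (hf' : Continuous f') :
    (∫ x in a..b, (deriv φ x * f' x - l * (φ x * f x))) + β * (φ b * f b) + β * (φ a * f a)
      = 0 := by
  have hc : Continuous f := continuous_iff_continuousAt.2 fun x => (hf x).continuousAt
  have h1 := h.continuous_deriv
  have h2 := h.contDiff.continuous
  have key : ∫ x in a..b, (deriv φ x * f' x - l * (φ x * f x))
      = deriv φ b * f b - deriv φ a * f a := by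
    refine intervalIntegral.integral_eq_sub_of_hasDerivAt (f := fun x => deriv φ x * f x)
      (fun x _ => ?_) (Continuous.intervalIntegrable (by fun_prop) _ _)
    exact ((h.ode x).mul (hf x)).congr_deriv (by ring)
  rw [key, h.left, h.right]
  ring

/-- Jacobi's argument: with `q = φ'/φ`, which solves the Riccati equation `q' = -l - q²`, the
integrand minus `(q f²)'` is the square `(f' - q f)²`. The Robin conditions give `q = ∓β` at the
right and left ends, so the boundary terms cancel. -/
theorem rayleigh (hab : a ≤ b) (h : IsRobinGroundState a b β l φ) {f f' : ℝ → ℝ}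
    (hf : ∀ x, HasDerivAt f (f' x) x) (hf' : Continuous f') :
    0 ≤ (∫ x in a..b, (f' x * f' x - l * (f x * f x))) + β * (f b * f b) + β * (f a * f a) := by
  have hc : Continuous f := continuous_iff_continuousAt.2 fun x => (hf x).continuousAt
  have h1 := h.continuous_deriv
  have h2 := h.contDiff.continuous
  have hcont : ContinuousOn (fun x => (-l - (deriv φ x / φ x) ^ 2) * f x ^ 2
      + deriv φ x / φ x * (2 * f x * f' x)) (Icc a b) := by
    have : ContinuousOn (fun x => deriv φ x / φ x) (Icc a b) :=
      h1.continuousOn.div h2.continuousOn fun x hx => (h.pos x hx).ne'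
    fun_prop
  have hint := (uIcc_of_le hab ▸ hcont).intervalIntegrable (μ := volume)
  have key : ∫ x in a..b, ((-l - (deriv φ x / φ x) ^ 2) * f x ^ 2
      + deriv φ x / φ x * (2 * f x * f' x))
      = deriv φ b / φ b * f b ^ 2 - deriv φ a / φ a * f a ^ 2 := by
    refine intervalIntegral.integral_eq_sub_of_hasDerivAt
      (f := fun x => deriv φ x / φ x * f x ^ 2) (fun x hx => ?_) hint
    rw [uIcc_of_le hab] at hx
    have hx' := (h.pos x hx).ne'
    refine (((h.ode x).div (h.hasDerivAt x) hx').mul ((hf x).pow 2)).congr_deriv ?_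
    simp only [Pi.pow_apply, Pi.div_apply]
    field_simp
    ring
  have hmono : ∫ x in a..b, ((-l - (deriv φ x / φ x) ^ 2) * f x ^ 2
      + deriv φ x / φ x * (2 * f x * f' x)) ≤ ∫ x in a..b, (f' x * f' x - l * (f x * f x)) := by
    refine intervalIntegral.integral_mono_on hab hint
      (Continuous.intervalIntegrable (by fun_prop) _ _) fun x _ => ?_
    nlinarith [sq_nonneg (f' x - deriv φ x / φ x * f x)]
  rw [key, h.left, h.right, mul_div_cancel_right₀ _ (h.pos b (right_mem_Icc.2 hab)).ne',
    mul_div_cancel_right₀ _ (h.pos a (left_mem_Icc.2 hab)).ne'] at hmono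
  linarith

end IsRobinGroundState

/-! ### Bounded functions and limits in L² -/

theorem Continuous.memLp_of_isCompact {X : Type*} [TopologicalSpace X] [MeasurableSpace X]
    [OpensMeasurableSpace X] {μ : Measure X} [IsFiniteMeasure μ] {f : X → ℝ} (hf : Continuous f)
    {K : Set X} (hK : IsCompact K) (h : ∀ᵐ x ∂μ, x ∈ K) (p : ℝ≥0∞) : MemLp f p μ := by
  obtain ⟨C, hC⟩ := hK.exists_bound_of_continuousOn hf.continuousOn
  exact MemLp.of_bound hf.measurable.aestronglyMeasurable C (h.mono hC)

theorem MeasureTheory.tendsto_integral_mul_of_tendsto_eLpNorm {X : Type*} [MeasurableSpace X]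
    {μ : Measure X} {F G : ℕ → X → ℝ} {f g : X → ℝ} (hF : ∀ n, MemLp (F n) 2 μ)
    (hG : ∀ n, MemLp (G n) 2 μ) (hf : MemLp f 2 μ) (hg : MemLp g 2 μ)
    (hFf : Tendsto (fun n => eLpNorm (fun x => F n x - f x) 2 μ) atTop (𝓝 0))
    (hGg : Tendsto (fun n => eLpNorm (fun x => G n x - g x) 2 μ) atTop (𝓝 0)) :
    Tendsto (fun n => ∫ x, F n x * G n x ∂μ) atTop (𝓝 (∫ x, f x * g x ∂μ)) := by
  have inner_eq : ∀ {u v : X → ℝ} (hu : MemLp u 2 μ) (hv : MemLp v 2 μ),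
      inner ℝ (hv.toLp v) (hu.toLp u) = ∫ x, u x * v x ∂μ := by
    intro u v hu hv
    rw [L2.inner_def]
    refine integral_congr_ae ?_
    filter_upwards [hu.coeFn_toLp, hv.coeFn_toLp] with x h1 h2
    rw [h1, h2]
    simp
  have h1 := (Lp.tendsto_Lp_iff_tendsto_eLpNorm'' F hF f hf).2 hFf
  have h2 := (Lp.tendsto_Lp_iff_tendsto_eLpNorm'' G hG g hg).2 hGg
  have := h2.inner (𝕜 := ℝ) h1
  simpa only [inner_eq] using this

/-! ### Integration over a rectangle and its boundary -/

namespace Rectangle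

variable (R : Rectangle)

theorem interiorMeasure_eq_prod : R.interiorMeasure
    = (volume.restrict (Ioo R.x₀ R.x₁)).prod (volume.restrict (Ioo R.y₀ R.y₁)) := by
  rw [interiorMeasure, carrier, Measure.volume_eq_prod, Measure.prod_restrict]

theorem measurableSet_carrier : MeasurableSet R.carrier :=
  measurableSet_Ioo.prod measurableSet_Ioo

/-- The closed rectangle. -/
def closedCarrier : Set (ℝ × ℝ) := Icc R.x₀ R.x₁ ×ˢ Icc R.y₀ R.y₁

theorem isCompact_closedCarrier : IsCompact R.closedCarrier := isCompact_Icc.prod isCompact_Icc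

theorem carrier_subset_closedCarrier : R.carrier ⊆ R.closedCarrier :=
  prod_mono Ioo_subset_Icc_self Ioo_subset_Icc_self

instance : IsFiniteMeasure R.interiorMeasure := by
  rw [interiorMeasure_eq_prod]
  infer_instance

instance : IsFiniteMeasure R.boundaryMeasure := by
  unfold boundaryMeasure
  infer_instance

theorem ae_interiorMeasure_mem_carrier : ∀ᵐ z ∂(R.interiorMeasure), z ∈ R.carrier :=
  ae_restrict_mem R.measurableSet_carrier

theorem ae_interiorMeasure_mem : ∀ᵐ z ∂(R.interiorMeasure), z ∈ R.closedCarrier :=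
  R.ae_interiorMeasure_mem_carrier.mono fun _ hz => R.carrier_subset_closedCarrier hz

theorem ae_boundaryMeasure_mem : ∀ᵐ z ∂(R.boundaryMeasure), z ∈ R.closedCarrier := by
  have hm : MeasurableSet {z | z ∈ R.closedCarrier} :=
    measurableSet_Icc.prod measurableSet_Icc
  have hx := R.hx.le
  have hy := R.hy.le
  simp only [boundaryMeasure, ae_add_measure_iff]
  refine ⟨⟨⟨?_, ?_⟩, ?_⟩, ?_⟩ <;>
  · refine (ae_map_iff (by fun_prop) hm).2 ?_
    filter_upwards [ae_restrict_mem measurableSet_Icc] with s hs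
    simp_all [closedCarrier]

theorem _root_.Continuous.memLp_interiorMeasure {f : ℝ × ℝ → ℝ} (hf : Continuous f) (p : ℝ≥0∞) :
    MemLp f p R.interiorMeasure :=
  hf.memLp_of_isCompact R.isCompact_closedCarrier R.ae_interiorMeasure_mem p

theorem _root_.Continuous.memLp_boundaryMeasure {f : ℝ × ℝ → ℝ} (hf : Continuous f) (p : ℝ≥0∞) :
    MemLp f p R.boundaryMeasure :=
  hf.memLp_of_isCompact R.isCompact_closedCarrier R.ae_boundaryMeasure_mem p

theorem _root_.Continuous.integrable_interiorMeasure {f : ℝ × ℝ → ℝ} (hf : Continuous f) :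
    Integrable f R.interiorMeasure :=
  memLp_one_iff_integrable.1 (hf.memLp_interiorMeasure R 1)

theorem _root_.Continuous.integrable_boundaryMeasure {f : ℝ × ℝ → ℝ} (hf : Continuous f) :
    Integrable f R.boundaryMeasure :=
  memLp_one_iff_integrable.1 (hf.memLp_boundaryMeasure R 1)

theorem integral_interiorMeasure {f : ℝ × ℝ → ℝ} (hf : Continuous f) :
    ∫ z, f z ∂(R.interiorMeasure) = ∫ x in R.x₀..R.x₁, ∫ y in R.y₀..R.y₁, f (x, y) := by
  have hi := hf.integrable_interiorMeasure R
  rw [interiorMeasure_eq_prod] at hi ⊢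
  rw [integral_prod f hi]
  simp only [intervalIntegral.integral_of_le R.hx.le, intervalIntegral.integral_of_le R.hy.le,
    integral_Ioc_eq_integral_Ioo]

theorem integral_interiorMeasure_symm {f : ℝ × ℝ → ℝ} (hf : Continuous f) :
    ∫ z, f z ∂(R.interiorMeasure) = ∫ y in R.y₀..R.y₁, ∫ x in R.x₀..R.x₁, f (x, y) := by
  have hi := hf.integrable_interiorMeasure R
  rw [interiorMeasure_eq_prod] at hi ⊢
  rw [integral_prod_symm f hi]
  simp only [intervalIntegral.integral_of_le R.hx.le, intervalIntegral.integral_of_le R.hy.le,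
    integral_Ioc_eq_integral_Ioo]

theorem integral_boundaryMeasure {f : ℝ × ℝ → ℝ} (hf : Continuous f) :
    ∫ z, f z ∂(R.boundaryMeasure) = (∫ x in R.x₀..R.x₁, f (x, R.y₀)) + (∫ x in R.x₀..R.x₁, f (x, R.y₁))
      + (∫ y in R.y₀..R.y₁, f (R.x₀, y)) + (∫ y in R.y₀..R.y₁, f (R.x₁, y)) := by
  have hi := hf.integrable_boundaryMeasure R
  simp only [intervalIntegral.integral_of_le R.hx.le, intervalIntegral.integral_of_le R.hy.le,
    ← integral_Icc_eq_integral_Ioc]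
  unfold boundaryMeasure at hi ⊢
  have h4 := hi.right_of_add_measure
  have h123 := hi.left_of_add_measure
  have h3 := h123.right_of_add_measure
  have h12 := h123.left_of_add_measure
  rw [integral_add_measure h123 h4, integral_add_measure h12 h3,
    integral_add_measure h12.left_of_add_measure h12.right_of_add_measure,
    integral_map (by fun_prop) hf.measurable.aestronglyMeasurable,
    integral_map (by fun_prop) hf.measurable.aestronglyMeasurable,
    integral_map (by fun_prop) hf.measurable.aestronglyMeasurable,
    integral_map (by fun_prop) hf.measurable.aestronglyMeasurable]

/-- Fubini: horizontal slices end on the left and right sides, vertical slices on the bottom and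
top. Integrating the slice inequalities therefore counts each side exactly once. -/
theorem integral_add_boundary_nonneg {E₁ E₂ e : ℝ × ℝ → ℝ} (hE₁ : Continuous E₁)
    (hE₂ : Continuous E₂) (he : Continuous e)
    (h₁ : ∀ y ∈ Icc R.y₀ R.y₁,
      0 ≤ (∫ x in R.x₀..R.x₁, E₁ (x, y)) + e (R.x₁, y) + e (R.x₀, y))
    (h₂ : ∀ x ∈ Icc R.x₀ R.x₁,
      0 ≤ (∫ y in R.y₀..R.y₁, E₂ (x, y)) + e (x, R.y₁) + e (x, R.y₀)) :
    0 ≤ (∫ z, (E₁ z + E₂ z) ∂(R.interiorMeasure)) + ∫ z, e z ∂(R.boundaryMeasure) := by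
  rw [integral_add (hE₁.integrable_interiorMeasure R) (hE₂.integrable_interiorMeasure R),
    R.integral_interiorMeasure_symm hE₁, R.integral_interiorMeasure hE₂,
    R.integral_boundaryMeasure he]
  have c₁ : Continuous fun y => ∫ x in R.x₀..R.x₁, E₁ (x, y) :=
    intervalIntegral.continuous_parametric_intervalIntegral_of_continuous' (by fun_prop) _ _
  have c₂ : Continuous fun x => ∫ y in R.y₀..R.y₁, E₂ (x, y) :=
    intervalIntegral.continuous_parametric_intervalIntegral_of_continuous' (by fun_prop) _ _
  have i₁ := intervalIntegral.integral_nonneg R.hy.le (μ := volume) h₁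
  have i₂ := intervalIntegral.integral_nonneg R.hx.le (μ := volume) h₂
  rw [intervalIntegral.integral_add, intervalIntegral.integral_add] at i₁ i₂
  · linarith
  all_goals exact Continuous.intervalIntegrable (by fun_prop) _ _

theorem integral_add_boundary_eq_zero {E₁ E₂ e : ℝ × ℝ → ℝ} (hE₁ : Continuous E₁)
    (hE₂ : Continuous E₂) (he : Continuous e)
    (h₁ : ∀ y, (∫ x in R.x₀..R.x₁, E₁ (x, y)) + e (R.x₁, y) + e (R.x₀, y) = 0)
    (h₂ : ∀ x, (∫ y in R.y₀..R.y₁, E₂ (x, y)) + e (x, R.y₁) + e (x, R.y₀) = 0) :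
    (∫ z, (E₁ z + E₂ z) ∂(R.interiorMeasure)) + ∫ z, e z ∂(R.boundaryMeasure) = 0 := by
  have hp := R.integral_add_boundary_nonneg hE₁ hE₂ he (fun y _ => (h₁ y).ge)
    (fun x _ => (h₂ x).ge)
  have hn := R.integral_add_boundary_nonneg (E₁ := fun z => -E₁ z) (E₂ := fun z => -E₂ z)
    (e := fun z => -e z) hE₁.neg hE₂.neg he.neg
    (fun y _ => by
      have := h₁ y
      simp only [intervalIntegral.integral_neg]
      linarith)
    (fun x _ => by
      have := h₂ x
      simp only [intervalIntegral.integral_neg]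
      linarith)
  simp only [← neg_add, integral_neg] at hn
  linarith

end Rectangle

/-! ### Smooth functions in H¹ and continuity of the Robin form -/

theorem hasWeakDeriv_fderiv {Ω : Set (ℝ × ℝ)} (w : ℝ × ℝ) {f : ℝ × ℝ → ℝ} (hf : ContDiff ℝ ∞ f) :
    HasWeakDeriv Ω w f fun z => fderiv ℝ f z w := by
  intro φ hφ hφc hφΩ
  have cφ : Continuous φ := hφ.continuous
  have cφ' : Continuous fun z => fderiv ℝ φ z w :=
    (hφ.continuous_fderiv (by simp)).clm_apply continuous_const
  have cf : Continuous f := hf.continuous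
  have cf' : Continuous fun z => fderiv ℝ f z w :=
    (hf.continuous_fderiv (by simp)).clm_apply continuous_const
  have supp' : HasCompactSupport fun z => fderiv ℝ φ z w := hφc.fderiv_apply (𝕜 := ℝ) w
  rw [setIntegral_eq_integral_of_forall_compl_eq_zero,
    setIntegral_eq_integral_of_forall_compl_eq_zero]
  · have : (volume : Measure (ℝ × ℝ)).IsAddHaarMeasure := by
      rw [Measure.volume_eq_prod]; infer_instance
    refine integral_mul_fderiv_eq_neg_fderiv_mul_of_integrable ?_ ?_ ?_
      (fun x _ => hf.differentiable (by simp) x) (fun x _ => hφ.differentiable (by simp) x)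
    · exact (cf'.mul cφ).integrable_of_hasCompactSupport hφc.mul_left
    · exact (cf.mul cφ').integrable_of_hasCompactSupport supp'.mul_left
    · exact (cf.mul cφ).integrable_of_hasCompactSupport hφc.mul_left
  · intro z hz
    rw [image_eq_zero_of_notMem_tsupport fun h => hz (hφΩ h), mul_zero]
  · intro z hz
    have : fderiv ℝ φ z = 0 := image_eq_zero_of_notMem_tsupport fun h =>
      hz (hφΩ (tsupport_fderiv_subset ℝ h))
    rw [this]
    simp

/-- A smooth function on the plane, as an element of `H¹(R)`. -/
noncomputable def SobolevH1.ofContDiff (R : Rectangle) {f : ℝ × ℝ → ℝ} (hf : ContDiff ℝ ∞ f) :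
    SobolevH1 R where
  u := f
  dx := fun z => fderiv ℝ f z (1, 0)
  dy := fun z => fderiv ℝ f z (0, 1)
  memLp_u := hf.continuous.memLp_interiorMeasure R 2
  memLp_dx := ((hf.continuous_fderiv (by simp)).clm_apply
    continuous_const).memLp_interiorMeasure R 2
  memLp_dy := ((hf.continuous_fderiv (by simp)).clm_apply
    continuous_const).memLp_interiorMeasure R 2
  hasWeakDeriv_dx := hasWeakDeriv_fderiv (1, 0) hf
  hasWeakDeriv_dy := hasWeakDeriv_fderiv (0, 1) hf

/-- `f` is a sequence of smooth functions that exhibits `g` as the boundary trace of `v`. -/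
structure IsTraceSeq {R : Rectangle} (v : SobolevH1 R) (g : ℝ × ℝ → ℝ) (f : ℕ → ℝ × ℝ → ℝ) :
    Prop where
  memLp : MemLp g 2 R.boundaryMeasure
  contDiff : ∀ n, ContDiff ℝ ∞ (f n)
  tendsto_u : Tendsto (fun n => eLpNorm (fun z => f n z - v.u z) 2 R.interiorMeasure) atTop (𝓝 0)
  tendsto_dx : Tendsto (fun n => eLpNorm (fun z => fderiv ℝ (f n) z (1, 0) - v.dx z) 2
    R.interiorMeasure) atTop (𝓝 0)
  tendsto_dy : Tendsto (fun n => eLpNorm (fun z => fderiv ℝ (f n) z (0, 1) - v.dy z) 2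
    R.interiorMeasure) atTop (𝓝 0)
  tendsto_trace : Tendsto (fun n => eLpNorm (fun z => f n z - g z) 2 R.boundaryMeasure) atTop (𝓝 0)

theorem IsTraceSeq.isTrace {R : Rectangle} {v : SobolevH1 R} {g : ℝ × ℝ → ℝ}
    {f : ℕ → ℝ × ℝ → ℝ} (h : IsTraceSeq v g f) : IsTrace v g :=
  ⟨h.memLp, f, h.contDiff, h.tendsto_u, h.tendsto_dx, h.tendsto_dy, h.tendsto_trace⟩

theorem IsTrace.exists_isTraceSeq {R : Rectangle} {v : SobolevH1 R} {g : ℝ × ℝ → ℝ}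
    (h : IsTrace v g) : ∃ f, IsTraceSeq v g f := by
  obtain ⟨h0, f, h1, h2, h3, h4, h5⟩ := h
  exact ⟨f, h0, h1, h2, h3, h4, h5⟩

theorem isTraceSeq_ofContDiff (R : Rectangle) {f : ℝ × ℝ → ℝ} (hf : ContDiff ℝ ∞ f) :
    IsTraceSeq (SobolevH1.ofContDiff R hf) f fun _ => f := by
  refine ⟨hf.continuous.memLp_boundaryMeasure R 2, fun _ => hf, ?_, ?_, ?_, ?_⟩ <;>
  simp [SobolevH1.ofContDiff]

/-- The bilinear form `∫_R ∇u·∇v + β ∫_{∂R} u v - l ∫_R u v`, where `g` and `h` are the boundary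
values of `u` and `v`. -/
noncomputable def robinForm {R : Rectangle} (β l : ℝ) (u v : SobolevH1 R) (g h : ℝ × ℝ → ℝ) : ℝ :=
  (∫ z, (u.dx z * v.dx z + u.dy z * v.dy z) ∂(R.interiorMeasure))
    + β * (∫ z, g z * h z ∂(R.boundaryMeasure)) - l * ∫ z, u.u z * v.u z ∂(R.interiorMeasure)

/-- Reduces statements about the form to smooth functions. Since `IsTrace` supplies an approximating
sequence, neither a density theorem nor a trace inequality is needed. -/
theorem tendsto_robinForm {R : Rectangle} (β l : ℝ) {u v : SobolevH1 R} {g h : ℝ × ℝ → ℝ}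
    {F G : ℕ → ℝ × ℝ → ℝ} (hF : IsTraceSeq u g F) (hG : IsTraceSeq v h G) :
    Tendsto (fun n => robinForm β l (SobolevH1.ofContDiff R (hF.contDiff n))
      (SobolevH1.ofContDiff R (hG.contDiff n)) (F n) (G n)) atTop (𝓝 (robinForm β l u v g h)) := by
  have split : ∀ u v : SobolevH1 R, ∫ z, (u.dx z * v.dx z + u.dy z * v.dy z) ∂(R.interiorMeasure)
      = (∫ z, u.dx z * v.dx z ∂(R.interiorMeasure)) + ∫ z, u.dy z * v.dy z ∂(R.interiorMeasure) :=
    fun u v => integral_add (u.memLp_dx.integrable_mul v.memLp_dx)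
      (u.memLp_dy.integrable_mul v.memLp_dy)
  simp only [robinForm, split]
  refine ((Tendsto.add ?_ ?_).add (Tendsto.const_mul β ?_)).sub (Tendsto.const_mul l ?_)
  · exact tendsto_integral_mul_of_tendsto_eLpNorm (fun n => SobolevH1.memLp_dx _)
      (fun n => SobolevH1.memLp_dx _) u.memLp_dx v.memLp_dx hF.tendsto_dx hG.tendsto_dx
  · exact tendsto_integral_mul_of_tendsto_eLpNorm (fun n => SobolevH1.memLp_dy _)
      (fun n => SobolevH1.memLp_dy _) u.memLp_dy v.memLp_dy hF.tendsto_dy hG.tendsto_dy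
  · exact tendsto_integral_mul_of_tendsto_eLpNorm
      (fun n => (hF.contDiff n).continuous.memLp_boundaryMeasure R 2)
      (fun n => (hG.contDiff n).continuous.memLp_boundaryMeasure R 2) hF.memLp hG.memLp
      hF.tendsto_trace hG.tendsto_trace
  · exact tendsto_integral_mul_of_tendsto_eLpNorm (fun n => SobolevH1.memLp_u _)
      (fun n => SobolevH1.memLp_u _) u.memLp_u v.memLp_u hF.tendsto_u hG.tendsto_u

theorem hasDerivAt_fst_of_contDiff {f : ℝ × ℝ → ℝ} (hf : ContDiff ℝ ∞ f) (x y : ℝ) :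
    HasDerivAt (fun s => f (s, y)) (fderiv ℝ f (x, y) (1, 0)) x :=
  (hf.differentiable (by simp) (x, y)).hasFDerivAt.comp_hasDerivAt x
    ((hasDerivAt_id x).prodMk (hasDerivAt_const x y))

theorem hasDerivAt_snd_of_contDiff {f : ℝ × ℝ → ℝ} (hf : ContDiff ℝ ∞ f) (x y : ℝ) :
    HasDerivAt (fun s => f (x, s)) (fderiv ℝ f (x, y) (0, 1)) y :=
  (hf.differentiable (by simp) (x, y)).hasFDerivAt.comp_hasDerivAt y
    ((hasDerivAt_const y x).prodMk (hasDerivAt_id y))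

/-! ### Separation of variables on the rectangle -/

section GroundState

variable {R : Rectangle} {β l₁ l₂ : ℝ} {φ ψ : ℝ → ℝ}

/-- Assigns `l₁` to the horizontal and `l₂` to the vertical energy, so that each can be treated
slice by slice. -/
theorem robinForm_ofContDiff {u v : ℝ × ℝ → ℝ} (hu : ContDiff ℝ ∞ u) (hv : ContDiff ℝ ∞ v) :
    robinForm β (l₁ + l₂) (SobolevH1.ofContDiff R hu) (SobolevH1.ofContDiff R hv) u v =
      (∫ z, ((fderiv ℝ u z (1, 0) * fderiv ℝ v z (1, 0) - l₁ * (u z * v z)) +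
        (fderiv ℝ u z (0, 1) * fderiv ℝ v z (0, 1) - l₂ * (u z * v z))) ∂(R.interiorMeasure))
      + ∫ z, β * (u z * v z) ∂(R.boundaryMeasure) := by
  have c1 := (hu.continuous_fderiv (by simp)).clm_apply (continuous_const (y := ((1 : ℝ), (0 : ℝ))))
  have c2 := (hv.continuous_fderiv (by simp)).clm_apply (continuous_const (y := ((1 : ℝ), (0 : ℝ))))
  have c3 := (hu.continuous_fderiv (by simp)).clm_apply (continuous_const (y := ((0 : ℝ), (1 : ℝ))))
  have c4 := (hv.continuous_fderiv (by simp)).clm_apply (continuous_const (y := ((0 : ℝ), (1 : ℝ))))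
  have c5 := hu.continuous
  have c6 := hv.continuous
  rw [robinForm, integral_const_mul, ← integral_const_mul (l₁ + l₂), add_sub_right_comm]
  congr 1
  rw [← integral_sub]
  · exact integral_congr_ae (Eventually.of_forall fun z => by simp [SobolevH1.ofContDiff]; ring)
  · exact Continuous.integrable_interiorMeasure R ((c1.mul c2).add (c3.mul c4))
  · exact Continuous.integrable_interiorMeasure R (continuous_const.mul (c5.mul c6))

theorem robinForm_groundState (hφ : IsRobinGroundState R.x₀ R.x₁ β l₁ φ)
    (hψ : IsRobinGroundState R.y₀ R.y₁ β l₂ ψ) {u : ℝ × ℝ → ℝ}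
    (hu : ContDiff ℝ ∞ u) (hu_eq : ∀ x y, u (x, y) = φ x * ψ y) {f : ℝ × ℝ → ℝ}
    (hf : ContDiff ℝ ∞ f) :
    robinForm β (l₁ + l₂) (SobolevH1.ofContDiff R hu) (SobolevH1.ofContDiff R hf) u f = 0 := by
  have c1 := (hu.continuous_fderiv (by simp)).clm_apply (continuous_const (y := ((1 : ℝ), (0 : ℝ))))
  have c2 := (hf.continuous_fderiv (by simp)).clm_apply (continuous_const (y := ((1 : ℝ), (0 : ℝ))))
  have c3 := (hu.continuous_fderiv (by simp)).clm_apply (continuous_const (y := ((0 : ℝ), (1 : ℝ))))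
  have c4 := (hf.continuous_fderiv (by simp)).clm_apply (continuous_const (y := ((0 : ℝ), (1 : ℝ))))
  have c5 := hu.continuous
  have c6 := hf.continuous
  rw [robinForm_ofContDiff]
  refine R.integral_add_boundary_eq_zero (by fun_prop) (by fun_prop) (by fun_prop)
    (fun y => ?_) (fun x => ?_)
  · have hux : ∀ x, fderiv ℝ u (x, y) (1, 0) = deriv φ x * ψ y := fun x =>
      (hasDerivAt_fst_of_contDiff hu x y).unique
        (by simpa only [hu_eq] using (hφ.hasDerivAt x).mul_const (ψ y))
    have := hφ.weak_eq (fun x => hasDerivAt_fst_of_contDiff hf x y) (by fun_prop)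
    simp only [hux, hu_eq]
    have e : ∀ x, deriv φ x * ψ y * fderiv ℝ f (x, y) (1, 0) - l₁ * (φ x * ψ y * f (x, y))
      = ψ y * (deriv φ x * fderiv ℝ f (x, y) (1, 0) - l₁ * (φ x * f (x, y))) := fun x => by ring
    simp only [e, intervalIntegral.integral_const_mul]
    linear_combination ψ y * this
  · have huy : ∀ y, fderiv ℝ u (x, y) (0, 1) = φ x * deriv ψ y := fun y =>
      (hasDerivAt_snd_of_contDiff hu x y).unique
        (by simpa only [hu_eq] using (hψ.hasDerivAt y).const_mul (φ x))
    have := hψ.weak_eq (fun y => hasDerivAt_snd_of_contDiff hf x y) (by fun_prop)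
    simp only [huy, hu_eq]
    have e : ∀ y, φ x * deriv ψ y * fderiv ℝ f (x, y) (0, 1) - l₂ * (φ x * ψ y * f (x, y))
      = φ x * (deriv ψ y * fderiv ℝ f (x, y) (0, 1) - l₂ * (ψ y * f (x, y))) := fun x => by ring
    simp only [e, intervalIntegral.integral_const_mul]
    linear_combination φ x * this

theorem robinForm_self_nonneg_of_contDiff (hφ : IsRobinGroundState R.x₀ R.x₁ β l₁ φ)
    (hψ : IsRobinGroundState R.y₀ R.y₁ β l₂ ψ) {f : ℝ × ℝ → ℝ} (hf : ContDiff ℝ ∞ f) :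
    0 ≤ robinForm β (l₁ + l₂) (SobolevH1.ofContDiff R hf) (SobolevH1.ofContDiff R hf) f f := by
  have c2 := (hf.continuous_fderiv (by simp)).clm_apply (continuous_const (y := ((1 : ℝ), (0 : ℝ))))
  have c4 := (hf.continuous_fderiv (by simp)).clm_apply (continuous_const (y := ((0 : ℝ), (1 : ℝ))))
  have c6 := hf.continuous
  rw [robinForm_ofContDiff]
  exact R.integral_add_boundary_nonneg (by fun_prop) (by fun_prop) (by fun_prop)
    (fun y _ => hφ.rayleigh R.hx.le (fun x => hasDerivAt_fst_of_contDiff hf x y) (by fun_prop))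
    (fun x _ => hψ.rayleigh R.hy.le (fun y => hasDerivAt_snd_of_contDiff hf x y) (by fun_prop))

theorem isLeast_isRobinEigenvalue (hφ : IsRobinGroundState R.x₀ R.x₁ β l₁ φ)
    (hψ : IsRobinGroundState R.y₀ R.y₁ β l₂ ψ) :
    IsLeast {l : ℝ | IsRobinEigenvalue R β l} (l₁ + l₂) := by
  constructor
  · have hu : ContDiff ℝ ∞ fun z : ℝ × ℝ => φ z.1 * ψ z.2 :=
      (hφ.contDiff.comp contDiff_fst).mul (hψ.contDiff.comp contDiff_snd)
    refine ⟨SobolevH1.ofContDiff R hu, _, (isTraceSeq_ofContDiff R hu).isTrace, ?_, ?_⟩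
    · intro h0
      have hfalse : ∀ᵐ z ∂(R.interiorMeasure), False := by
        filter_upwards [h0, R.ae_interiorMeasure_mem] with z hz hzR
        exact (mul_pos (hφ.pos _ hzR.1) (hψ.pos _ hzR.2)).ne' hz
      have hz : R.interiorMeasure = 0 := by simpa using hfalse
      have := R.area_eq
      rw [hz] at this
      have hpos : 0 < R.area := mul_pos (sub_pos.2 R.hx) (sub_pos.2 R.hy)
      simp at this
      exact hpos.ne' this
    · intro v h hv
      obtain ⟨f, hf⟩ := hv.exists_isTraceSeq
      have := tendsto_robinForm β (l₁ + l₂) (isTraceSeq_ofContDiff R hu) hf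
      simp only [fun n => robinForm_groundState hφ hψ hu (fun x y => rfl) (hf.contDiff n)] at this
      exact sub_eq_zero.1 (tendsto_nhds_unique this tendsto_const_nhds)
  · rintro l ⟨u, g, hug, hu0, hl⟩
    obtain ⟨f, hf⟩ := hug.exists_isTraceSeq
    have h1 : 0 ≤ robinForm β (l₁ + l₂) u u g g :=
      ge_of_tendsto' (tendsto_robinForm β (l₁ + l₂) hf hf)
        fun n => robinForm_self_nonneg_of_contDiff hφ hψ (hf.contDiff n)
    -- Testing the eigenvalue equation with `u` itself turns the form into `(l - (l₁ + l₂)) ∫ u²`.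
    rw [robinForm, hl u g hug, ← sub_mul] at h1
    have h2 : 0 < ∫ z, u.u z * u.u z ∂(R.interiorMeasure) := by
      refine lt_of_le_of_ne (integral_nonneg fun z => mul_self_nonneg _) fun h => hu0 ?_
      have := (integral_eq_zero_iff_of_nonneg (fun z => mul_self_nonneg (u.u z))
        (u.memLp_u.integrable_mul u.memLp_u)).1 h.symm
      filter_upwards [this] with z hz
      exact mul_self_eq_zero.1 hz
    exact sub_nonneg.1 (nonneg_of_mul_nonneg_left h1 h2)

theorem scaledLambda1_eq {α : ℝ} (hφ : IsRobinGroundState R.x₀ R.x₁ (α / R.perimeter) l₁ φ)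
    (hψ : IsRobinGroundState R.y₀ R.y₁ (α / R.perimeter) l₂ ψ) :
    scaledLambda1 α R = (l₁ + l₂) * R.area := by
  rw [scaledLambda1, robinLambda1, (isLeast_isRobinEigenvalue hφ hψ).csInf_eq]

end GroundState

/-! ### Comparison with the cube by Cauchy's mean value theorem -/

section CauchyComparison

variable {I : Set ℝ} {t P t' P' Φ : ℝ → ℝ}

/-- If `dP / d(t³)` decreases, then the secant slopes of `P` against `t` on the two halves of an
interval bisected by `t` satisfy a cross-ratio bound. -/
theorem cross_mul_lt_of_antitoneOn (hI : I.OrdConnected) (ht : ∀ x ∈ I, HasDerivAt t (t' x) x)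
    (hP : ∀ x ∈ I, HasDerivAt P (P' x) x) (tpos : ∀ x ∈ I, 0 < t x) (ht' : ∀ x ∈ I, 0 < t' x)
    (Φpos : ∀ x ∈ I, 0 < Φ x) (hΦ : ∀ x ∈ I, P' x = Φ x * (t x ^ 2 * t' x))
    (hanti : AntitoneOn Φ I) {x₁ x₂ m : ℝ} (h₁ : x₁ ∈ I) (h₂ : x₂ ∈ I) (h1m : x₁ < m) (hm2 : m < x₂)
    (hm : 2 * t m = t x₁ + t x₂) (hlt : t x₁ < t x₂) :
    t x₂ * P x₁ + t x₁ * P x₂ < 2 * t m * P m := by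
  have hmI : m ∈ I := hI.out h₁ h₂ ⟨h1m.le, hm2.le⟩
  have slope : ∀ a ∈ I, ∀ b ∈ I, a < b →
      ∃ c ∈ Ioo a b, 3 * (P b - P a) = (t b ^ 3 - t a ^ 3) * Φ c := by
    intro a ha b hb hab
    have hsub : Icc a b ⊆ I := hI.out ha hb
    have hT : ∀ x ∈ I, HasDerivAt (fun x => t x ^ 3) (3 * t x ^ 2 * t' x) x := fun x hx => by
      simpa using (ht x hx).fun_pow 3
    obtain ⟨c, hc, e⟩ := exists_ratio_hasDerivAt_eq_ratio_slope P P' hab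
      (fun x hx => (hP x (hsub hx)).continuousAt.continuousWithinAt)
      (fun x hx => hP x (hsub (Ioo_subset_Icc_self hx))) (fun x => t x ^ 3)
      (fun x => 3 * t x ^ 2 * t' x)
      (fun x hx => (hT x (hsub hx)).continuousAt.continuousWithinAt)
      (fun x hx => hT x (hsub (Ioo_subset_Icc_self hx)))
    have hcI := hsub (Ioo_subset_Icc_self hc)
    -- `P'` and `(t³)'` share the factor `t² t'` at `c`; cancelling it leaves `Φ c`.
    refine ⟨c, hc, mul_right_cancel₀ (mul_pos (pow_pos (tpos c hcI) 2) (ht' c hcI)).ne' ?_⟩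
    rw [hΦ c hcI] at e
    linear_combination -e
  obtain ⟨c₁, hc₁, e₁⟩ := slope x₁ h₁ m hmI h1m
  obtain ⟨c₂, hc₂, e₂⟩ := slope m hmI x₂ h₂ hm2
  have hc₁I : c₁ ∈ I := hI.out h₁ hmI (Ioo_subset_Icc_self hc₁)
  have hc₂I : c₂ ∈ I := hI.out hmI h₂ (Ioo_subset_Icc_self hc₂)
  have hle := hanti hc₁I hc₂I (hc₁.2.trans hc₂.1).le
  have p₁ := tpos x₁ h₁
  have p₂ := tpos x₂ h₂
  obtain ⟨d, hd⟩ : ∃ d, d = (t x₂ - t x₁) / 2 := ⟨_, rfl⟩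
  have hdpos : 0 < d := by linarith
  have ha : t x₁ = t m - d := by linarith
  have hb : t x₂ = t m + d := by linarith
  rw [ha] at p₁
  rw [ha] at e₁
  rw [hb] at e₂
  rw [ha, hb]
  have hdm : d < t m := by linarith
  have hcube : 0 < t m ^ 3 - (t m - d) ^ 3 := by
    have : t m ^ 3 - (t m - d) ^ 3 = d * (t m ^ 2 + t m * (t m - d) + (t m - d) ^ 2) := by ring
    rw [this]
    have htm := hdpos.trans hdm
    positivity
  -- The required inequality for `P = t³`, with gap exactly `2d⁴`.
  have hmul : (t m - d) * ((t m + d) ^ 3 - t m ^ 3) < (t m + d) * (t m ^ 3 - (t m - d) ^ 3) := by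
    have : (t m + d) * (t m ^ 3 - (t m - d) ^ 3) - (t m - d) * ((t m + d) ^ 3 - t m ^ 3)
      = 2 * d ^ 4 := by ring
    linarith [pow_pos hdpos 4]
  have hfin : (t m - d) * (3 * (P x₂ - P m)) < (t m + d) * (3 * (P m - P x₁)) := by
    rw [e₁, e₂, ← mul_assoc, ← mul_assoc]
    calc (t m - d) * ((t m + d) ^ 3 - t m ^ 3) * Φ c₂
        < (t m + d) * (t m ^ 3 - (t m - d) ^ 3) * Φ c₂ :=
          mul_lt_mul_of_pos_right hmul (Φpos c₂ hc₂I)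
      _ ≤ _ := mul_le_mul_of_nonneg_left hle (mul_pos (by linarith) hcube).le
  linarith

end CauchyComparison

/-! ### Monotonicity of the hyperbolic and trigonometric ratios -/

theorem nonneg_of_hasDerivAt_nonneg {f f' : ℝ → ℝ} (hf : ∀ x, HasDerivAt f (f' x) x)
    (h0 : 0 ≤ f 0) (h : ∀ x, 0 ≤ x → 0 ≤ f' x) {x : ℝ} (hx : 0 ≤ x) : 0 ≤ f x := by
  have : MonotoneOn f (Ici 0) := monotoneOn_of_hasDerivWithinAt_nonneg (convex_Ici 0)
    (fun y _ => (hf y).continuousAt.continuousWithinAt) (fun y _ => (hf y).hasDerivWithinAt)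
    fun y hy => h y (interior_subset hy)
  exact h0.trans (this self_mem_Ici hx hx)

namespace Real

theorem cosh_ge_quartic (x : ℝ) : 1 + x ^ 2 / 2 + x ^ 4 / 24 ≤ cosh x := by
  have := sum_le_hasSum (Finset.range 3)
    (fun i _ => div_nonneg (Even.pow_nonneg (even_two_mul i) x) (Nat.cast_nonneg _)) (hasSum_cosh x)
  norm_num [Finset.sum_range_succ, Nat.factorial] at this
  exact this

/-- Differentiate the difference of the two sides four times: it and its first three derivatives
vanish at `0`, and the fourth is `8x cosh x + x² sinh x`. -/
theorem sinh_pade {x : ℝ} (hx : 0 ≤ x) : (12 - x ^ 2) * sinh x ≤ x * (12 + x ^ 2) := by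
  have s : ∀ x, HasDerivAt sinh (cosh x) x := hasDerivAt_sinh
  have c : ∀ x, HasDerivAt cosh (sinh x) x := hasDerivAt_cosh
  have q : ∀ (k x : ℝ), HasDerivAt (fun x => x ^ 2 + k) (2 * x) x := fun k x => by
    simpa using (hasDerivAt_pow 2 x).add_const k
  have i : ∀ x : ℝ, HasDerivAt (fun x => x) 1 x := hasDerivAt_id
  have h3 : ∀ x : ℝ, 0 ≤ x → 0 ≤ 6 + 6 * (x * sinh x) + (x ^ 2 + -6) * cosh x := fun x hx =>
    nonneg_of_hasDerivAt_nonneg (f := fun x => 6 + 6 * (x * sinh x) + (x ^ 2 + -6) * cosh x)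
      (f' := fun x => 8 * x * cosh x + x ^ 2 * sinh x)
      (fun x => (((((i x).mul (s x)).const_mul 6).const_add 6).add
        ((q (-6) x).mul (c x))).congr_deriv (by ring)) (by simp)
      (fun x hx => by have := cosh_pos x; have := sinh_nonneg_iff.2 hx; positivity) hx
  have h2 : ∀ x : ℝ, 0 ≤ x → 0 ≤ 6 * x + 4 * (x * cosh x) + (x ^ 2 + -10) * sinh x := fun x hx =>
    nonneg_of_hasDerivAt_nonneg (f := fun x => 6 * x + 4 * (x * cosh x) + (x ^ 2 + -10) * sinh x)
      (fun x => ((((i x).const_mul 6).add (((i x).mul (c x)).const_mul 4)).add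
        ((q (-10) x).mul (s x))).congr_deriv (by ring)) (by simp) h3 hx
  have h1 : ∀ x : ℝ, 0 ≤ x → 0 ≤ 3 * (x ^ 2 + 4) + 2 * (x * sinh x) + (x ^ 2 + -12) * cosh x :=
    fun x hx => nonneg_of_hasDerivAt_nonneg
      (f := fun x => 3 * (x ^ 2 + 4) + 2 * (x * sinh x) + (x ^ 2 + -12) * cosh x)
      (fun x => ((((q 4 x).const_mul 3).add (((i x).mul (s x)).const_mul 2)).add
        ((q (-12) x).mul (c x))).congr_deriv (by ring)) (by norm_num) h2 hx
  have h0 : 0 ≤ x * (x ^ 2 + 12) + (x ^ 2 + -12) * sinh x :=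
    nonneg_of_hasDerivAt_nonneg (f := fun x => x * (x ^ 2 + 12) + (x ^ 2 + -12) * sinh x)
      (fun x => (((i x).mul (q 12 x)).add ((q (-12) x).mul (s x))).congr_deriv (by ring))
      (by simp) h1 hx
  linarith

/-- The sign needed for the derivative of the hyperbolic ratio. The stronger `x² (cosh x + 1) ≤ sinh
x (sinh x + x)` holds, and what is left over is `2x (sinh² x - x²)`. -/
theorem sq_mul_cosh_mul_sinh_le {x : ℝ} (hx : 0 < x) :
    x ^ 2 * (cosh x + 1) * sinh x ≤ sinh x ^ 3 + 3 * x * sinh x ^ 2 - 2 * x ^ 3 := by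
  have hS : 0 < sinh x := sinh_pos_iff.2 hx
  have hxS : x ≤ sinh x := self_le_sinh_iff.2 hx.le
  have hC := cosh_ge_quartic x
  have hpos := cosh_pos x
  have hsq := cosh_sq x
  have h12 : 0 < 12 + x ^ 2 := by positivity
  have hpade := sinh_pade hx.le
  -- The quartic bound on `cosh x - 1`, multiplied by `cosh x + 1`.
  have a1 : x ^ 2 * (12 + x ^ 2) * (cosh x + 1) ≤ 24 * sinh x ^ 2 := by
    have : x ^ 2 * (12 + x ^ 2) ≤ 24 * (cosh x - 1) := by linarith
    nlinarith
  have a2 : 24 * sinh x ≤ (12 + x ^ 2) * (sinh x + x) := by linarith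
  have a3 : x ^ 2 * (cosh x + 1) ≤ sinh x * (sinh x + x) := by
    refine le_of_mul_le_mul_left ?_ h12
    nlinarith
  have a4 : 0 ≤ 2 * x * (sinh x ^ 2 - x ^ 2) := by
    have : x ^ 2 ≤ sinh x ^ 2 := pow_le_pow_left₀ hx.le hxS 2
    exact mul_nonneg (by linarith) (by linarith)
  nlinarith [mul_le_mul_of_nonneg_right a3 hS.le]

/-- The ratio is `P'/(t² t')` for `t = x tanh(x/2)` and `P = x coth(x/2)`, simplified by `sinh² =
(cosh + 1)(cosh - 1)`. -/
theorem antitoneOn_hyperbolic_ratio : AntitoneOn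
    (fun x => (cosh x + 1) ^ 2 * (sinh x - x) / (x ^ 2 * (sinh x + x) * (cosh x - 1) ^ 2))
    (Ioi 0) := by
  have hder : ∀ x ∈ Ioi (0 : ℝ), HasDerivAt
      (fun x => (cosh x + 1) ^ 2 * (sinh x - x) / (x ^ 2 * (sinh x + x) * (cosh x - 1) ^ 2))
      (2 * x * (cosh x + 1) * (cosh x - 1) * sinh x *
        (x ^ 2 * (cosh x + 1) * sinh x - sinh x ^ 3 - 3 * x * sinh x ^ 2 + 2 * x ^ 3) /
        (x ^ 2 * (sinh x + x) * (cosh x - 1) ^ 2) ^ 2) x := by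
    intro x hx
    have hx : 0 < x := hx
    have hS : 0 < sinh x := sinh_pos_iff.2 hx
    have hC : 0 < cosh x - 1 := sub_pos.2 (one_lt_cosh.2 hx.ne')
    have hpq : (cosh x + 1) * (cosh x - 1) = sinh x ^ 2 := by linear_combination cosh_sq x
    have hN : HasDerivAt (fun x => (cosh x + 1) ^ 2 * (sinh x - x))
        ((cosh x + 1) * sinh x * (3 * sinh x - 2 * x)) x := by
      refine ((((hasDerivAt_cosh x).add_const 1).fun_pow 2).mul
        ((hasDerivAt_sinh x).sub (hasDerivAt_id x))).congr_deriv ?_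
      simp
      linear_combination (cosh x + 1) * hpq
    have hD : HasDerivAt (fun x => x ^ 2 * (sinh x + x) * (cosh x - 1) ^ 2)
        ((cosh x - 1) * (2 * x * (sinh x + x) * (cosh x - 1) + x ^ 2 * sinh x ^ 2
          + 2 * x ^ 2 * (sinh x + x) * sinh x)) x := by
      refine (((hasDerivAt_pow 2 x).mul ((hasDerivAt_sinh x).add (hasDerivAt_id x))).mul
        (((hasDerivAt_cosh x).sub_const 1).fun_pow 2)).congr_deriv ?_
      simp
      linear_combination x ^ 2 * (cosh x - 1) * hpq
    refine (hN.div hD (by positivity)).congr_deriv ?_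
    congr 1
    linear_combination ((cosh x + 1) * (cosh x - 1) * x *
      (-(sinh x - x) * 2 * (sinh x + x))) * hpq
  refine antitoneOn_of_hasDerivWithinAt_nonpos (convex_Ioi 0)
    (fun y hy => (hder y hy).continuousAt.continuousWithinAt)
    (fun y hy => (hder y (interior_subset hy)).hasDerivWithinAt) fun x hx => ?_
  have hx : 0 < x := interior_subset hx
  have hS : 0 < sinh x := sinh_pos_iff.2 hx
  have hC : 0 < cosh x - 1 := sub_pos.2 (one_lt_cosh.2 hx.ne')
  have := cosh_pos x
  have key := sq_mul_cosh_mul_sinh_le hx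
  refine div_nonpos_of_nonpos_of_nonneg (mul_nonpos_of_nonneg_of_nonpos (by positivity) ?_)
    (by positivity)
  linarith

theorem cos_le_quartic {x : ℝ} (hx : 0 ≤ x) : cos x ≤ 1 - x ^ 2 / 2 + x ^ 4 / 24 := by
  have := nonneg_of_hasDerivAt_nonneg (f := fun x => 1 - x ^ 2 / 2 + x ^ 4 / 24 - cos x)
    (f' := fun x => sin x - (x - x ^ 3 / 6))
    (fun x => (((((hasDerivAt_pow 2 x).div_const 2).const_sub 1).add
      ((hasDerivAt_pow 4 x).div_const 24)).sub (hasDerivAt_cos x)).congr_deriv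
        (by simp; ring)) (by simp) (fun x hx => sub_nonneg.2 (sin_ge_sub_cube hx)) hx
  linarith

theorem sin_le_quintic {x : ℝ} (hx : 0 ≤ x) : sin x ≤ x - x ^ 3 / 6 + x ^ 5 / 120 := by
  have := nonneg_of_hasDerivAt_nonneg (f := fun x => x - x ^ 3 / 6 + x ^ 5 / 120 - sin x)
    (f' := fun x => 1 - x ^ 2 / 2 + x ^ 4 / 24 - cos x)
    (fun x => ((((hasDerivAt_id x).sub ((hasDerivAt_pow 3 x).div_const 6)).add
      ((hasDerivAt_pow 5 x).div_const 120)).sub (hasDerivAt_sin x)).congr_deriv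
        (by simp; ring)) (by simp) (fun x hx => sub_nonneg.2 (cos_le_quartic hx)) hx
  linarith

theorem mul_one_sub_cos_le {x : ℝ} (hx : x ∈ Ioo 0 π) : x * (1 - cos x) ≤ 6 * (x - sin x) := by
  have h0 := hx.1
  -- The Taylor bounds reduce the claim to `x⁵/20 ≤ x³/2`, that is `x² ≤ 10`, and `π² < 10`.
  have hsq : x ^ 2 ≤ 10 := by nlinarith [hx.2, pi_lt_d2]
  have h1 := sin_le_quintic h0.le
  have h2 : 1 - cos x ≤ x ^ 2 / 2 := by linarith [one_sub_sq_div_two_le_cos (x := x)]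
  have h3 := mul_le_mul_of_nonneg_left h2 h0.le
  have h4 := mul_le_mul_of_nonneg_left hsq (pow_pos h0 3).le
  nlinarith

/-- With `s = sin x`, the expression is exactly `x s (6(x - s) - x(1 - cos x)) + (x - s)((x - s)² +
x²)`. -/
theorem sin_cos_quotient_numerator_nonneg {x : ℝ} (hx : x ∈ Ioo 0 π) :
    0 ≤ x ^ 2 * (1 + cos x) * sin x - sin x ^ 3 - 3 * x * sin x ^ 2 + 2 * x ^ 3 := by
  have hn := sin_pos_of_mem_Ioo hx
  have hnx := sin_lt hx.1
  have h1 := mul_le_mul_of_nonneg_left (mul_one_sub_cos_le hx) (mul_pos hx.1 hn).le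
  have h2 : 0 ≤ (x - sin x) * ((x - sin x) ^ 2 + x ^ 2) :=
    mul_nonneg (by linarith) (by positivity)
  linarith

theorem antitoneOn_trigonometric_ratio : AntitoneOn
    (fun x => (1 + cos x) ^ 2 * (x - sin x) / (x ^ 2 * (x + sin x) * (1 - cos x) ^ 2))
    (Ioo 0 π) := by
  have aux : ∀ x ∈ Ioo (0 : ℝ) π, 0 < x ∧ 0 < sin x ∧ 0 < 1 - cos x ∧ 0 < 1 + cos x := by
    intro x hx
    have hn := sin_pos_of_mem_Ioo hx
    have := sin_sq_add_cos_sq x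
    exact ⟨hx.1, hn, by nlinarith [neg_one_le_cos x, cos_le_one x],
      by nlinarith [neg_one_le_cos x, cos_le_one x]⟩
  have hder : ∀ x ∈ Ioo (0 : ℝ) π, HasDerivAt
      (fun x => (1 + cos x) ^ 2 * (x - sin x) / (x ^ 2 * (x + sin x) * (1 - cos x) ^ 2))
      (-(2 * x * (1 + cos x) * (1 - cos x) * sin x *
        (x ^ 2 * (1 + cos x) * sin x - sin x ^ 3 - 3 * x * sin x ^ 2 + 2 * x ^ 3)) /
        (x ^ 2 * (x + sin x) * (1 - cos x) ^ 2) ^ 2) x := by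
    intro x hx
    obtain ⟨hx, hS, hC, -⟩ := aux x hx
    have hpq : (1 + cos x) * (1 - cos x) = sin x ^ 2 := by
      linear_combination -sin_sq_add_cos_sq x
    have hN : HasDerivAt (fun x => (1 + cos x) ^ 2 * (x - sin x))
        ((1 + cos x) * sin x * (3 * sin x - 2 * x)) x := by
      refine ((((hasDerivAt_cos x).const_add 1).fun_pow 2).mul
        ((hasDerivAt_id x).sub (hasDerivAt_sin x))).congr_deriv ?_
      simp
      linear_combination (1 + cos x) * hpq
    have hD : HasDerivAt (fun x => x ^ 2 * (x + sin x) * (1 - cos x) ^ 2)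
        ((1 - cos x) * (2 * x * (x + sin x) * (1 - cos x) + x ^ 2 * sin x ^ 2
          + 2 * x ^ 2 * (x + sin x) * sin x)) x := by
      refine (((hasDerivAt_pow 2 x).mul ((hasDerivAt_id x).add (hasDerivAt_sin x))).mul
        (((hasDerivAt_cos x).const_sub 1).fun_pow 2)).congr_deriv ?_
      simp
      linear_combination x ^ 2 * (1 - cos x) * hpq
    refine (hN.div hD (by positivity)).congr_deriv ?_
    congr 1
    linear_combination ((1 + cos x) * (1 - cos x) * x *
      (-(x - sin x) * 2 * (x + sin x))) * hpq
  refine antitoneOn_of_hasDerivWithinAt_nonpos (convex_Ioo 0 π)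
    (fun y hy => (hder y hy).continuousAt.continuousWithinAt)
    (fun y hy => (hder y (interior_subset hy)).hasDerivWithinAt) fun x hx => ?_
  have hx := interior_subset hx
  have key := sin_cos_quotient_numerator_nonneg hx
  obtain ⟨hx, hS, hC, hC'⟩ := aux x hx
  exact div_nonpos_of_nonpos_of_nonneg (neg_nonpos.2 (by positivity)) (by positivity)

end Real

/-! ### Explicit ground states -/

open Real in
theorem isRobinGroundState_cosh {a b β X : ℝ} (hab : a < b) (hX : 0 < X)
    (h : X * (cosh X - 1) / sinh X = -β * (b - a)) :
    IsRobinGroundState a b β (-X ^ 2 / (b - a) ^ 2)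
      fun x => cosh (X / (b - a) * (x - (a + b) / 2)) := by
  have hba : 0 < b - a := sub_pos.2 hab
  have harg : ∀ x, HasDerivAt (fun x => X / (b - a) * (x - (a + b) / 2)) (X / (b - a)) x :=
    fun x => by simpa using ((hasDerivAt_id x).sub_const ((a + b) / 2)).const_mul (X / (b - a))
  have hd : deriv (fun x => cosh (X / (b - a) * (x - (a + b) / 2)))
      = fun x => sinh (X / (b - a) * (x - (a + b) / 2)) * (X / (b - a)) :=
    funext fun x => (harg x).cosh.deriv
  have hb : X / (b - a) * (b - (a + b) / 2) = X / 2 := by field_simp; ring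
  have ha : X / (b - a) * (a - (a + b) / 2) = -(X / 2) := by field_simp; ring
  -- The hypothesis is `X tanh(X/2) = -β(b - a)` in half-angle form. This is the condition at `b`;
  -- evenness about the midpoint gives the one at `a`.
  have hhalf : sinh (X / 2) * (X / (b - a)) = -β * cosh (X / 2) := by
    have hs : 0 < sinh (X / 2) := sinh_pos_iff.2 (by positivity)
    have hc := cosh_pos (X / 2)
    have e2 : X = 2 * (X / 2) := by ring
    have eC : cosh X - 1 = 2 * sinh (X / 2) ^ 2 := by
      rw [e2, cosh_two_mul, ← e2]; linear_combination cosh_sq (X / 2)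
    have eS : sinh X = 2 * sinh (X / 2) * cosh (X / 2) := by rw [e2, sinh_two_mul, ← e2]
    rw [eC, eS] at h
    field_simp at h ⊢
    linarith
  refine ⟨contDiff_cosh.comp (by fun_prop), fun x _ => cosh_pos _, fun x => ?_, ?_, ?_⟩
  · rw [hd]
    exact ((harg x).sinh.mul_const _).congr_deriv (by field_simp)
  · rw [hd]
    simp only [ha, sinh_neg, cosh_neg]
    linarith
  · rw [hd]
    simp only [hb]
    exact hhalf

open Real in
theorem isRobinGroundState_cos {a b β X : ℝ} (hab : a < b) (hX : X ∈ Ioo 0 π)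
    (h : X * (1 - cos X) / sin X = β * (b - a)) :
    IsRobinGroundState a b β (X ^ 2 / (b - a) ^ 2)
      fun x => cos (X / (b - a) * (x - (a + b) / 2)) := by
  have hba : 0 < b - a := sub_pos.2 hab
  have hX0 := hX.1
  have harg : ∀ x, HasDerivAt (fun x => X / (b - a) * (x - (a + b) / 2)) (X / (b - a)) x :=
    fun x => by simpa using ((hasDerivAt_id x).sub_const ((a + b) / 2)).const_mul (X / (b - a))
  have hd : deriv (fun x => cos (X / (b - a) * (x - (a + b) / 2)))
      = fun x => -sin (X / (b - a) * (x - (a + b) / 2)) * (X / (b - a)) :=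
    funext fun x => (harg x).cos.deriv
  have hb : X / (b - a) * (b - (a + b) / 2) = X / 2 := by field_simp; ring
  have ha : X / (b - a) * (a - (a + b) / 2) = -(X / 2) := by field_simp; ring
  have hhalf : sin (X / 2) * (X / (b - a)) = β * cos (X / 2) := by
    have hs : 0 < sin (X / 2) := sin_pos_of_mem_Ioo ⟨by linarith, by linarith [hX.2]⟩
    have hc : 0 < cos (X / 2) := cos_pos_of_mem_Ioo
      ⟨by linarith [pi_pos], by linarith [hX.2]⟩
    have e2 : X = 2 * (X / 2) := by ring
    have eC : 1 - cos X = 2 * sin (X / 2) ^ 2 := by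
      rw [e2, cos_two_mul, ← e2]; linear_combination -2 * sin_sq_add_cos_sq (X / 2)
    have eS : sin X = 2 * sin (X / 2) * cos (X / 2) := by rw [e2, sin_two_mul, ← e2]
    rw [eC, eS] at h
    field_simp at h ⊢
    linarith
  refine ⟨contDiff_cos.comp (by fun_prop), fun x hx => cos_pos_of_mem_Ioo ?_, fun x => ?_, ?_, ?_⟩
  · have hmono : Monotone fun x => X / (b - a) * (x - (a + b) / 2) := fun x y hxy => by
      dsimp only
      gcongr
    have h1 := hmono hx.1
    have h2 := hmono hx.2
    simp only [ha, hb] at h1 h2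
    exact ⟨by linarith [hX.2], by linarith [hX.2]⟩
  · rw [hd]
    exact ((harg x).sin.neg.mul_const _).congr_deriv (by field_simp)
  · rw [hd]
    simp only [ha, sin_neg, cos_neg, neg_neg]
    exact hhalf
  · rw [hd]
    simp only [hb]
    linarith

/-! ### Profiles for the two signs of the Robin parameter -/

/-- A parametrization, on `I`, of the ground states of the one-dimensional Robin problem whose
parameter has the sign of `σ`: `t` is the absolute value of the product of the Robin parameter with
the length, and `-P * t` is the product of the eigenvalue with the square of the length. -/
structure IsRobinProfile (σ : ℝ) (I : Set ℝ) (t P : ℝ → ℝ) : Prop where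
  strictMonoOn : StrictMonoOn t I
  surj : ∀ s, 0 < s → ∃ X ∈ I, t X = s
  cross_lt : ∀ x₁ ∈ I, ∀ x₂ ∈ I, ∀ m ∈ I, x₁ < x₂ → 2 * t m = t x₁ + t x₂ →
    t x₂ * P x₁ + t x₁ * P x₂ < 2 * t m * P m
  groundState : ∀ a b β X, a < b → X ∈ I → 0 < β * σ → t X = |β| * (b - a) →
    ∃ φ, IsRobinGroundState a b β (-(P X * t X) / (b - a) ^ 2) φ

/-- The construction of a profile from the derivatives of `t` and `P`. -/
theorem IsRobinProfile.of_hasDerivAt {σ : ℝ} {I : Set ℝ} {t P t' P' Φ : ℝ → ℝ} (hI : Convex ℝ I)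
    (ht : ∀ x ∈ I, HasDerivAt t (t' x) x) (hP : ∀ x ∈ I, HasDerivAt P (P' x) x)
    (tpos : ∀ x ∈ I, 0 < t x) (ht' : ∀ x ∈ I, 0 < t' x) (Φpos : ∀ x ∈ I, 0 < Φ x)
    (hΦ : ∀ x ∈ I, P' x = Φ x * (t x ^ 2 * t' x)) (hanti : AntitoneOn Φ I)
    (surj : ∀ s, 0 < s → ∃ X ∈ I, t X = s)
    (groundState : ∀ a b β X, a < b → X ∈ I → 0 < β * σ → t X = |β| * (b - a) →
      ∃ φ, IsRobinGroundState a b β (-(P X * t X) / (b - a) ^ 2) φ) : IsRobinProfile σ I t P := by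
  have hmono : StrictMonoOn t I := strictMonoOn_of_hasDerivWithinAt_pos hI
    (fun x hx => (ht x hx).continuousAt.continuousWithinAt)
    (fun x hx => (ht x (interior_subset hx)).hasDerivWithinAt)
    fun x hx => ht' x (interior_subset hx)
  refine ⟨hmono, surj, fun x₁ h₁ x₂ h₂ m hm h12 hmid => ?_, groundState⟩
  have hlt := hmono h₁ h₂ h12
  exact cross_mul_lt_of_antitoneOn hI.ordConnected ht hP tpos ht' Φpos hΦ hanti h₁ h₂
    ((hmono.lt_iff_lt h₁ hm).1 (by linarith)) ((hmono.lt_iff_lt hm h₂).1 (by linarith)) hmid hlt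

open Real in
theorem isRobinProfile_hyperbolic : IsRobinProfile (-1) (Ioi 0)
    (fun x => x * (cosh x - 1) / sinh x) (fun x => x * (cosh x + 1) / sinh x) := by
  have aux : ∀ x ∈ Ioi (0 : ℝ), 0 < x ∧ 0 < sinh x ∧ 0 < cosh x - 1 ∧ 0 < sinh x - x :=
    fun x hx => ⟨hx, sinh_pos_iff.2 hx, sub_pos.2 (one_lt_cosh.2 (ne_of_gt hx)),
      sub_pos.2 (self_lt_sinh_iff.2 hx)⟩
  have hder : ∀ x ∈ Ioi (0 : ℝ), HasDerivAt (fun x => x * (cosh x - 1) / sinh x)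
      ((cosh x - 1) * (sinh x + x) / sinh x ^ 2) x := fun x hx => by
    have hS := (aux x hx).2.1
    refine (((hasDerivAt_id x).mul ((hasDerivAt_cosh x).sub_const 1)).div (hasDerivAt_sinh x)
      hS.ne').congr_deriv ?_
    simp
    congr 1
    linear_combination -x * cosh_sq x
  refine .of_hasDerivAt (t' := fun x => (cosh x - 1) * (sinh x + x) / sinh x ^ 2)
    (P' := fun x => (cosh x + 1) * (sinh x - x) / sinh x ^ 2) (convex_Ioi 0) hder
    (fun x hx => ?_) (fun x hx => ?_) (fun x hx => ?_) (fun x hx => ?_) (fun x hx => ?_)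
    antitoneOn_hyperbolic_ratio (fun s hs => ?_) fun a b β X hab hX hβ h => ?_
  · have hS := (aux x hx).2.1
    refine (((hasDerivAt_id x).mul ((hasDerivAt_cosh x).add_const 1)).div (hasDerivAt_sinh x)
      hS.ne').congr_deriv ?_
    simp
    congr 1
    linear_combination -x * cosh_sq x
  · obtain ⟨h0, hS, hC, hSx⟩ := aux x hx
    positivity
  · obtain ⟨h0, hS, hC, hSx⟩ := aux x hx
    positivity
  · obtain ⟨h0, hS, hC, hSx⟩ := aux x hx
    have := cosh_pos x
    positivity
  · obtain ⟨h0, hS, hC, hSx⟩ := aux x hx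
    have hpq : (cosh x + 1) * (cosh x - 1) = sinh x ^ 2 := by linear_combination cosh_sq x
    have : 0 < sinh x + x := by positivity
    field_simp
    linear_combination (-1) * hpq
  · have hcont : ContinuousOn (fun x => x * (cosh x - 1) / sinh x) (Icc s (2 * s + 2)) :=
      fun x hx => (hder x (hs.trans_le hx.1)).continuousAt.continuousWithinAt
    -- `tanh(X/2) ≤ 1` puts the value at `s` below `s`; at `2s + 2` one has `tanh(X/2) ≥ 1/2`, hence
    -- a value of at least `s + 1`.
    have hmem : s ∈ Icc (s * (cosh s - 1) / sinh s)
        ((2 * s + 2) * (cosh (2 * s + 2) - 1) / sinh (2 * s + 2)) := by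
      constructor
      · rw [div_le_iff₀ (sinh_pos_iff.2 hs)]
        have : cosh s - sinh s ≤ 1 := by
          rw [cosh_sub_sinh]; exact exp_le_one_iff.2 (by linarith)
        nlinarith
      · have h2 := sinh_lt_cosh (2 * s + 2)
        have h3 := cosh_ge_quartic (2 * s + 2)
        have h4 : 2 ≤ cosh (2 * s + 2) := by
          nlinarith [pow_pos hs 2, pow_nonneg (by linarith : 0 ≤ 2 * s + 2) 4]
        rw [le_div_iff₀ (sinh_pos_iff.2 (by linarith))]
        nlinarith
    obtain ⟨X, hX, e⟩ := intermediate_value_Icc (by linarith) hcont hmem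
    exact ⟨X, hs.trans_le hX.1, e⟩
  · obtain ⟨h0, hS, hC, hSx⟩ := aux X hX
    have hβ' : β < 0 := by linarith
    rw [abs_of_neg hβ'] at h
    have e : X * (cosh X + 1) / sinh X * (X * (cosh X - 1) / sinh X) = X ^ 2 := by
      field_simp
      linear_combination cosh_sq X
    simp only [e]
    exact ⟨_, isRobinGroundState_cosh hab hX h⟩

open Real in
theorem isRobinProfile_trigonometric : IsRobinProfile 1 (Ioo 0 π)
    (fun x => x * (1 - cos x) / sin x) (fun x => -(x * (1 + cos x) / sin x)) := by
  have aux : ∀ x ∈ Ioo (0 : ℝ) π, 0 < x ∧ 0 < sin x ∧ 0 < 1 - cos x ∧ 0 < x - sin x ∧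
      0 < 1 + cos x := by
    intro x hx
    have hn := sin_pos_of_mem_Ioo hx
    have := sin_sq_add_cos_sq x
    exact ⟨hx.1, hn, by nlinarith [neg_one_le_cos x, cos_le_one x], sub_pos.2 (sin_lt hx.1),
      by nlinarith [neg_one_le_cos x, cos_le_one x]⟩
  refine .of_hasDerivAt (t' := fun x => (1 - cos x) * (x + sin x) / sin x ^ 2)
    (P' := fun x => (1 + cos x) * (x - sin x) / sin x ^ 2) (convex_Ioo 0 π)
    (fun x hx => ?_) (fun x hx => ?_) (fun x hx => ?_) (fun x hx => ?_) (fun x hx => ?_)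
    (fun x hx => ?_) antitoneOn_trigonometric_ratio (fun s hs => ?_) fun a b β X hab hX hβ h => ?_
  · have hS := (aux x hx).2.1
    refine (((hasDerivAt_id x).mul ((hasDerivAt_cos x).const_sub 1)).div (hasDerivAt_sin x)
      hS.ne').congr_deriv ?_
    simp
    congr 1
    linear_combination x * sin_sq_add_cos_sq x
  · have hS := (aux x hx).2.1
    refine (((hasDerivAt_id x).mul ((hasDerivAt_cos x).const_add 1)).div (hasDerivAt_sin x)
      hS.ne').neg.congr_deriv ?_
    simp
    rw [← neg_div]
    congr 1
    linear_combination x * sin_sq_add_cos_sq x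
  · obtain ⟨h0, hS, hC, hSx, hC'⟩ := aux x hx
    positivity
  · obtain ⟨h0, hS, hC, hSx, hC'⟩ := aux x hx
    positivity
  · obtain ⟨h0, hS, hC, hSx, hC'⟩ := aux x hx
    positivity
  · obtain ⟨h0, hS, hC, hSx, hC'⟩ := aux x hx
    have hpq : (1 + cos x) * (1 - cos x) = sin x ^ 2 := by
      linear_combination -sin_sq_add_cos_sq x
    have : 0 < x + sin x := by positivity
    field_simp
    linear_combination (-1) * hpq
  -- With `X = 2y` the equation is `2y tan y = s`; clearing the cosine avoids the pole at `π/2`.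
  · have hcont : ContinuousOn (fun y => 2 * y * sin y - s * cos y) (Icc 0 (π / 2)) := by fun_prop
    have hmem : (0 : ℝ) ∈ Ioo (2 * 0 * sin 0 - s * cos 0)
        (2 * (π / 2) * sin (π / 2) - s * cos (π / 2)) := by
      simpa using ⟨hs, pi_pos⟩
    obtain ⟨y, hy, e⟩ := intermediate_value_Ioo (by positivity) hcont hmem
    have hs' : 0 < sin y := sin_pos_of_mem_Ioo ⟨hy.1, by linarith [hy.2, pi_pos]⟩
    have hc' : 0 < cos y := cos_pos_of_mem_Ioo ⟨by linarith [hy.1, pi_pos], hy.2⟩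
    refine ⟨2 * y, ⟨by linarith [hy.1], by linarith [hy.2]⟩, ?_⟩
    have eC : 1 - cos (2 * y) = 2 * sin y ^ 2 := by
      rw [cos_two_mul]; linear_combination -2 * sin_sq_add_cos_sq y
    dsimp only at e ⊢
    rw [eC, sin_two_mul]
    field_simp
    linarith
  · obtain ⟨h0, hS, hC, hSx, hC'⟩ := aux X hX
    have hβ' : 0 < β := by linarith
    rw [abs_of_pos hβ'] at h
    have e : -(-(X * (1 + cos X) / sin X) * (X * (1 - cos X) / sin X)) = X ^ 2 := by
      field_simp
      linear_combination -sin_sq_add_cos_sq X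
    simp only [e]
    exact ⟨_, isRobinGroundState_cos hab hX h⟩

/-! ### Scaling and comparison with the square -/

namespace Rectangle

theorem width_pos (R : Rectangle) : 0 < R.width := sub_pos.2 R.hx

theorem height_pos (R : Rectangle) : 0 < R.height := sub_pos.2 R.hy

theorem perimeter_pos (R : Rectangle) : 0 < R.perimeter :=
  mul_pos two_pos (add_pos R.width_pos R.height_pos)

theorem width_dilate (R : Rectangle) (t : ℝ) (ht : 0 < t) :
    (R.dilate t ht).width = t * R.width := (mul_sub ..).symm

theorem height_dilate (R : Rectangle) (t : ℝ) (ht : 0 < t) :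
    (R.dilate t ht).height = t * R.height := (mul_sub ..).symm

theorem perimeter_dilate (R : Rectangle) (t : ℝ) (ht : 0 < t) :
    (R.dilate t ht).perimeter = t * R.perimeter := by
  rw [perimeter, width_dilate, height_dilate, perimeter]
  ring

end Rectangle

namespace IsRobinProfile

variable {α σ : ℝ} {I : Set ℝ} {t P : ℝ → ℝ}

theorem exists_groundStates (h : IsRobinProfile σ I t P) (hα : 0 < α * σ) (R : Rectangle)
    {X Y : ℝ} (hX : X ∈ I) (hY : Y ∈ I) (hXw : t X = |α| / R.perimeter * R.width)
    (hYh : t Y = |α| / R.perimeter * R.height) :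
    (∃ φ, IsRobinGroundState R.x₀ R.x₁ (α / R.perimeter) (-(P X * t X) / R.width ^ 2) φ) ∧
      ∃ ψ, IsRobinGroundState R.y₀ R.y₁ (α / R.perimeter) (-(P Y * t Y) / R.height ^ 2) ψ := by
  have hL := R.perimeter_pos
  have hβ : 0 < α / R.perimeter * σ := by
    rw [div_mul_eq_mul_div]
    exact div_pos hα hL
  have habs : |α / R.perimeter| = |α| / R.perimeter := by rw [abs_div, abs_of_pos hL]
  exact ⟨h.groundState _ _ _ X R.hx hX hβ (by rw [habs]; exact hXw),
    h.groundState _ _ _ Y R.hy hY hβ (by rw [habs]; exact hYh)⟩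

theorem exists_params (h : IsRobinProfile σ I t P) (hα : α ≠ 0) (R : Rectangle) :
    ∃ X ∈ I, ∃ Y ∈ I, t X = |α| / R.perimeter * R.width ∧ t Y = |α| / R.perimeter * R.height := by
  have hc := div_pos (abs_pos.2 hα) R.perimeter_pos
  obtain ⟨X, hX, e⟩ := h.surj _ (mul_pos hc R.width_pos)
  obtain ⟨Y, hY, e'⟩ := h.surj _ (mul_pos hc R.height_pos)
  exact ⟨X, hX, Y, hY, e, e'⟩

/-- Since `t X` and `t Y` are proportional to width and height, multiplying by the area replaces `t
X / width²` by `t Y`, and symmetrically. -/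
theorem scaledLambda1_eq (h : IsRobinProfile σ I t P) (hα : 0 < α * σ) (R : Rectangle)
    {X Y : ℝ} (hX : X ∈ I) (hY : Y ∈ I) (hXw : t X = |α| / R.perimeter * R.width)
    (hYh : t Y = |α| / R.perimeter * R.height) :
    scaledLambda1 α R = -(t Y * P X + t X * P Y) := by
  obtain ⟨⟨φ, hφ⟩, ψ, hψ⟩ := h.exists_groundStates hα R hX hY hXw hYh
  have hw := R.width_pos
  have hh := R.height_pos
  rw [_root_.scaledLambda1_eq hφ hψ, Rectangle.area, hXw, hYh]
  field_simp
  ring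

theorem robin_square_minimizes (h : IsRobinProfile σ I t P) (hα : 0 < α * σ) :
    (∀ R : Rectangle, IsLeast {l : ℝ | IsRobinEigenvalue R (α / R.perimeter) l}
      (robinLambda1 R (α / R.perimeter))) ∧
    (∀ (R : Rectangle) (t : ℝ) (ht : 0 < t),
      scaledLambda1 α (R.dilate t ht) = scaledLambda1 α R) ∧
    (∀ S : Rectangle, S.IsSquare → ∀ R : Rectangle,
      scaledLambda1 α S ≤ scaledLambda1 α R ∧
      (scaledLambda1 α R = scaledLambda1 α S ↔ R.IsSquare)) := by
  have hα0 : α ≠ 0 := left_ne_zero_of_mul hα.ne'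
  refine ⟨fun R => ?_, fun R s hs => ?_, fun S hS R => ?_⟩
  · obtain ⟨X, hX, Y, hY, hXw, hYh⟩ := h.exists_params hα0 R
    obtain ⟨⟨φ, hφ⟩, ψ, hψ⟩ := h.exists_groundStates hα R hX hY hXw hYh
    have := isLeast_isRobinEigenvalue hφ hψ
    rwa [robinLambda1, this.csInf_eq]
  · obtain ⟨X, hX, Y, hY, hXw, hYh⟩ := h.exists_params hα0 R
    -- The same `X` and `Y` serve the dilated rectangle, because width and height over perimeter do
    -- not change.
    rw [h.scaledLambda1_eq hα R hX hY hXw hYh, h.scaledLambda1_eq hα _ hX hY]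
    · rw [hXw, R.perimeter_dilate, R.width_dilate]
      field_simp
    · rw [hYh, R.perimeter_dilate, R.height_dilate]
      field_simp
  · obtain ⟨X, hX, Y, hY, hXw, hYh⟩ := h.exists_params hα0 R
    obtain ⟨Z, hZ, -, -, hZw, -⟩ := h.exists_params hα0 S
    have hS' : S.width = S.height := hS
    have hc := div_pos (abs_pos.2 hα0) R.perimeter_pos
    -- Both sides equal `|α|/2`: this is what the normalization by perimeter achieves.
    have hmid : 2 * t Z = t X + t Y := by
      have hw := S.width_pos
      have hp : 0 < R.width + R.height := add_pos R.width_pos R.height_pos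
      rw [hZw, hXw, hYh, Rectangle.perimeter, Rectangle.perimeter, ← hS']
      field_simp
      ring
    rw [h.scaledLambda1_eq hα R hX hY hXw hYh, h.scaledLambda1_eq hα S hZ hZ hZw (hS' ▸ hZw)]
    have hsq : R.IsSquare ↔ X = Y := by
      rw [← h.strictMonoOn.injOn.eq_iff hX hY, hXw, hYh, mul_right_inj' hc.ne']
      rfl
    rw [hsq]
    rcases lt_trichotomy X Y with hlt | rfl | hlt
    · have := h.cross_lt X hX Y hY Z hZ hlt hmid
      exact ⟨by linarith, fun e => absurd e (by linarith), fun e => absurd e hlt.ne⟩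
    · have : Z = X := h.strictMonoOn.injOn hZ hX (by linarith)
      subst this
      exact ⟨le_rfl, fun _ => rfl, fun _ => rfl⟩
    · have := h.cross_lt Y hY X hX Z hZ hlt (by linarith)
      exact ⟨by linarith, fun e => absurd e (by linarith), fun e => absurd e hlt.ne'⟩

end IsRobinProfile

theorem mainTheorem1 (α : ℝ) (hα : α ≠ 0) :
    -- `λ₁(R; α/L)` is well defined, as the smallest Robin eigenvalue
    (∀ R : Rectangle, IsLeast {l : ℝ | IsRobinEigenvalue R (α / R.perimeter) l}
      (robinLambda1 R (α / R.perimeter))) ∧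
    -- `λ₁(R; α/L) A` is invariant under scaling
    (∀ (R : Rectangle) (t : ℝ) (ht : 0 < t),
      scaledLambda1 α (R.dilate t ht) = scaledLambda1 α R) ∧
    -- it is minimal for the square and only the square
    (∀ S : Rectangle, S.IsSquare → ∀ R : Rectangle,
      scaledLambda1 α S ≤ scaledLambda1 α R ∧
      (scaledLambda1 α R = scaledLambda1 α S ↔ R.IsSquare)) := by
  rcases hα.lt_or_gt with hneg | hpos
  · exact isRobinProfile_hyperbolic.robin_square_minimizes (by linarith)
  · exact isRobinProfile_trigonometric.robin_square_minimizes (by linarith)
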